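/- Setting. $\mathcal D'(\mathbb R)$ is the space of complex-valued distributions on $\mathbb R$. Let $\mathcal E_M(\mathbb R)$ be the algebra of nets $(u_\varepsilon)_{\varepsilon\in(0,1]}$ of smooth functions $u_\varepsilon:\mathbb R\to\mathbb C$ such that for every compact $K\subset\mathbb R$ and $k\in\mathbb N_0$ there is $N\ge 0$ with $\sup_{K}|u_\varepsilon^{(k)}|=O(\varepsilon^{-N})$ as $\varepsilon\to0$, let $\mathcal N(\mathbb R)$ be the ideal of those nets for which $\sup_{K}|u_\varepsilon^{(k)}|=O(\varepsilon^{m})$ for all $K$, $k$ and all $m\ge 0$, and let $\mathcal G(\mathbb R)=\mathcal E_M(\mathbb R)/\mathcal N(\mathbb R)$ be the special Colombeau algebra, with operations and differentiation defined componentwise; smooth functions (such as $x$) are regarded as elements of $\mathcal G(\mathbb R)$ via constant nets. For $u,v\in\mathcal G(\mathbb R)$ with representatives $(u_\varepsilon)_\varepsilon$, $(v_\varepsilon)_\varepsilon$, write $u\approx v$ ($u$ is associated to $v$) if $\int_{\mathbb R}(u_\varepsilon-v_\varepsilon)\varphi\,dx\to0$ as $\varepsilon\to0$ for all test functions $\varphi\in\mathcal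 D(\mathbb R)$; this does not depend on the representatives. Let $\rho\in\mathcal S(\mathbb R)$ satisfy $\int\rho\,dx=1$ and $\int x^k\rho(x)\,dx=0$ for all $k\ge1$, and put $\rho_\varepsilon(x)=\varepsilon^{-1}\rho(x/\varepsilon)$. Let $(U_j)_{j\in J}$ be a covering of $\mathbb R$ by relatively compact open sets, $(\chi_j)_{j\in J}$ a smooth partition of unity with $\operatorname{supp}\chi_j\subset U_j$, and $\psi_j\in\mathcal D(\mathbb R)$ with $\psi_j=1$ in a neighborhood of $\overline{U_j}$. The corresponding embedding $\iota:\mathcal D'(\mathbb R)\to\mathcal G(\mathbb R)$ is $$\iota(w)=\Big[\Big(\sum_{j\in J}\chi_j\cdot\big((\psi_j w)*\rho_\varepsilon\big)\Big)_{\varepsilon}\Big].$$ Theorem. Let $w\in\mathcal D'(\mathbb R)$, $u=\iota(w)$ and $\alpha\in\mathbb R$. The following are equivalent: 1. $w$ solves $xw'=\alpha w$ in $\mathcal D'(\mathbb R)$; 2. $u$ solves $xu'\approx\alpha u$ in $\mathcal G(\mathbb R)$. -/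

import Mathlib

open scoped Distributions SchwartzMap LineDeriv Manifold ContDiff Topology

noncomputable section

namespace Colombeau

/-! ### The special Colombeau algebra on the real line -/

/-- The parameter interval `(0, 1]`. -/
abbrev Eps : Type := Set.Ioc (0 : ℝ) 1

/-- The filter `ε → 0` on `(0, 1]`. -/
def epsZero : Filter Eps := Filter.comap Subtype.val (𝓝 0)

/-- Nets `(u_ε)` of complex valued functions on the real line, indexed by `ε ∈ (0, 1]`. -/
abbrev Net : Type := Eps → ℝ → ℂ

/-- Moderate nets of smooth functions: on each compact set, each derivative is `O(ε ^ (-N))`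
uniformly, for some `N`. -/
structure IsModerate (u : Net) : Prop where
  smooth : ∀ ε, ContDiff ℝ ∞ (u ε)
  bound : ∀ K : Set ℝ, IsCompact K → ∀ k : ℕ, ∃ N : ℕ, ∃ C : ℝ, ∀ᶠ ε in epsZero, ∀ x ∈ K,
    ‖iteratedDeriv k (u ε) x‖ ≤ C * ((ε : ℝ)⁻¹) ^ N

/-- Negligible nets of smooth functions: on each compact set, each derivative is `O(ε ^ m)`
uniformly, for all `m`. -/
structure IsNegligible (u : Net) : Prop where
  smooth : ∀ ε, ContDiff ℝ ∞ (u ε)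
  bound : ∀ K : Set ℝ, IsCompact K → ∀ k : ℕ, ∀ m : ℕ, ∃ C : ℝ, ∀ᶠ ε in epsZero, ∀ x ∈ K,
    ‖iteratedDeriv k (u ε) x‖ ≤ C * (ε : ℝ) ^ m

theorem Eps.pos (ε : Eps) : 0 < (ε : ℝ) := ε.2.1

theorem Eps.one_le_inv (ε : Eps) : 1 ≤ (ε : ℝ)⁻¹ := (one_le_inv₀ ε.pos).2 ε.2.2

theorem contDiffAt_of_smooth {f : ℝ → ℂ} (hf : ContDiff ℝ ∞ f) (k : ℕ) (x : ℝ) :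
    ContDiffAt ℝ (k : ℕ∞ω) f x :=
  (hf.of_le (by exact_mod_cast le_top)).contDiffAt

/-- All derivatives up to order `k` can be bounded with the same power of `ε`. -/
theorem IsModerate.bound_le {u : Net} (hu : IsModerate u) {K : Set ℝ} (hK : IsCompact K) (k : ℕ) :
    ∃ N : ℕ, ∃ C : ℝ, 0 ≤ C ∧ ∀ᶠ ε in epsZero, ∀ i ≤ k, ∀ x ∈ K,
      ‖iteratedDeriv i (u ε) x‖ ≤ C * ((ε : ℝ)⁻¹) ^ N := by
  choose N C h using hu.bound K hK
  refine ⟨∑ i ∈ Finset.range (k + 1), N i, ∑ i ∈ Finset.range (k + 1), |C i|,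
    Finset.sum_nonneg fun i _ => abs_nonneg _, ?_⟩
  have h' : ∀ᶠ ε in epsZero, ∀ i ∈ Finset.range (k + 1), ∀ x ∈ K,
      ‖iteratedDeriv i (u ε) x‖ ≤ C i * ((ε : ℝ)⁻¹) ^ N i :=
    (Filter.eventually_all_finset _).2 fun i _ => h i
  filter_upwards [h'] with ε hε i hi x hx
  have hi' : i ∈ Finset.range (k + 1) := Finset.mem_range.2 (by omega)
  have hinv := ε.one_le_inv
  calc ‖iteratedDeriv i (u ε) x‖ ≤ C i * ((ε : ℝ)⁻¹) ^ N i := hε i hi' x hx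
    _ ≤ |C i| * ((ε : ℝ)⁻¹) ^ N i := by gcongr; exact le_abs_self _
    _ ≤ |C i| * ((ε : ℝ)⁻¹) ^ (∑ i ∈ Finset.range (k + 1), N i) := by
        gcongr
        exact Finset.single_le_sum (f := N) (fun _ _ => Nat.zero_le _) hi'
    _ ≤ _ := by
        gcongr
        exact Finset.single_le_sum (f := fun i => |C i|) (fun _ _ => abs_nonneg _) hi'

/-- All derivatives up to order `k` can be bounded with the same constant. -/
theorem IsNegligible.bound_le {u : Net} (hu : IsNegligible u) {K : Set ℝ} (hK : IsCompact K)
    (k m : ℕ) : ∃ C : ℝ, 0 ≤ C ∧ ∀ᶠ ε in epsZero, ∀ i ≤ k, ∀ x ∈ K,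
      ‖iteratedDeriv i (u ε) x‖ ≤ C * (ε : ℝ) ^ m := by
  choose C h using fun i => hu.bound K hK i m
  refine ⟨∑ i ∈ Finset.range (k + 1), |C i|, Finset.sum_nonneg fun i _ => abs_nonneg _, ?_⟩
  have h' : ∀ᶠ ε in epsZero, ∀ i ∈ Finset.range (k + 1), ∀ x ∈ K,
      ‖iteratedDeriv i (u ε) x‖ ≤ C i * (ε : ℝ) ^ m :=
    (Filter.eventually_all_finset _).2 fun i _ => h i
  filter_upwards [h'] with ε hε i hi x hx
  have hi' : i ∈ Finset.range (k + 1) := Finset.mem_range.2 (by omega)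
  have hpos := ε.pos
  calc ‖iteratedDeriv i (u ε) x‖ ≤ C i * (ε : ℝ) ^ m := hε i hi' x hx
    _ ≤ _ := by
        gcongr
        exact (le_abs_self _).trans
          (Finset.single_le_sum (f := fun i => |C i|) (fun _ _ => abs_nonneg _) hi')

theorem norm_iteratedDeriv_mul_le {f g : ℝ → ℂ} (hf : ContDiff ℝ ∞ f) (hg : ContDiff ℝ ∞ g)
    {k : ℕ} {x A B : ℝ} (hA : ∀ i ≤ k, ‖iteratedDeriv i f x‖ ≤ A)
    (hB : ∀ i ≤ k, ‖iteratedDeriv i g x‖ ≤ B) :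
    ‖iteratedDeriv k (f * g) x‖ ≤ 2 ^ k * (A * B) := by
  have hA0 : 0 ≤ A := (norm_nonneg _).trans (hA 0 (Nat.zero_le _))
  rw [← norm_iteratedFDeriv_eq_norm_iteratedDeriv]
  refine (norm_iteratedFDeriv_mul_le hf hg x (by exact_mod_cast le_top)).trans ?_
  have h2 : (2 : ℝ) ^ k = ∑ i ∈ Finset.range (k + 1), (k.choose i : ℝ) := by
    exact_mod_cast (Nat.sum_range_choose k).symm
  rw [h2, Finset.sum_mul]
  refine Finset.sum_le_sum fun i hi => ?_
  rw [norm_iteratedFDeriv_eq_norm_iteratedDeriv, norm_iteratedFDeriv_eq_norm_iteratedDeriv, mul_assoc]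
  have hi' : i ≤ k := by have := Finset.mem_range.1 hi; omega
  gcongr
  · exact hA i hi'
  · exact hB _ (Nat.sub_le _ _)

theorem IsModerate.add {u v : Net} (hu : IsModerate u) (hv : IsModerate v) :
    IsModerate (u + v) := by
  refine ⟨fun ε => (hu.smooth ε).add (hv.smooth ε), fun K hK k => ?_⟩
  obtain ⟨N, C, hC, h⟩ := hu.bound_le hK k
  obtain ⟨N', C', hC', h'⟩ := hv.bound_le hK k
  refine ⟨N + N', C + C', ?_⟩
  filter_upwards [h, h'] with ε hε hε' x hx
  have hinv := ε.one_le_inv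
  rw [Pi.add_apply, iteratedDeriv_add (contDiffAt_of_smooth (hu.smooth ε) k x)
    (contDiffAt_of_smooth (hv.smooth ε) k x), add_mul]
  refine (norm_add_le _ _).trans (add_le_add ?_ ?_)
  · refine (hε k le_rfl x hx).trans ?_
    gcongr
    omega
  · refine (hε' k le_rfl x hx).trans ?_
    gcongr
    omega

theorem IsModerate.mul {u v : Net} (hu : IsModerate u) (hv : IsModerate v) :
    IsModerate (u * v) := by
  refine ⟨fun ε => (hu.smooth ε).mul (hv.smooth ε), fun K hK k => ?_⟩
  obtain ⟨N, C, hC, h⟩ := hu.bound_le hK k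
  obtain ⟨N', C', hC', h'⟩ := hv.bound_le hK k
  refine ⟨N + N', 2 ^ k * (C * C'), ?_⟩
  filter_upwards [h, h'] with ε hε hε' x hx
  refine (norm_iteratedDeriv_mul_le (hu.smooth ε) (hv.smooth ε) (fun i hi => hε i hi x hx)
    (fun i hi => hε' i hi x hx)).trans_eq ?_
  rw [pow_add]
  ring

/-- A smooth function, as a constant net, is moderate. -/
theorem isModerate_const {f : ℝ → ℂ} (hf : ContDiff ℝ ∞ f) : IsModerate fun _ => f := by
  refine ⟨fun _ => hf, fun K hK k => ⟨0, ?_⟩⟩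
  obtain ⟨C, hC⟩ := hK.exists_bound_of_continuousOn
    (hf.continuous_iteratedDeriv k (by exact_mod_cast le_top)).continuousOn
  exact ⟨C, Filter.Eventually.of_forall fun ε x hx => by simpa using hC x hx⟩

theorem IsNegligible.isModerate {u : Net} (hu : IsNegligible u) : IsModerate u :=
  ⟨hu.smooth, fun K hK k => ⟨0, by simpa using hu.bound K hK k 0⟩⟩

theorem isNegligible_zero : IsNegligible 0 :=
  ⟨fun _ => contDiff_const, fun K _ k m => ⟨0, Filter.Eventually.of_forall fun ε x _ => by
    simp⟩⟩

theorem IsNegligible.add {u v : Net} (hu : IsNegligible u) (hv : IsNegligible v) :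
    IsNegligible (u + v) := by
  refine ⟨fun ε => (hu.smooth ε).add (hv.smooth ε), fun K hK k m => ?_⟩
  obtain ⟨C, h⟩ := hu.bound K hK k m
  obtain ⟨C', h'⟩ := hv.bound K hK k m
  refine ⟨C + C', ?_⟩
  filter_upwards [h, h'] with ε hε hε' x hx
  rw [Pi.add_apply, iteratedDeriv_add (contDiffAt_of_smooth (hu.smooth ε) k x)
    (contDiffAt_of_smooth (hv.smooth ε) k x), add_mul]
  exact (norm_add_le _ _).trans (add_le_add (hε x hx) (hε' x hx))

theorem IsNegligible.mul_left {u v : Net} (hu : IsModerate u) (hv : IsNegligible v) :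
    IsNegligible (u * v) := by
  refine ⟨fun ε => (hu.smooth ε).mul (hv.smooth ε), fun K hK k m => ?_⟩
  obtain ⟨N, C, hC, h⟩ := hu.bound_le hK k
  obtain ⟨C', hC', h'⟩ := hv.bound_le hK k (N + m)
  refine ⟨2 ^ k * (C * C'), ?_⟩
  filter_upwards [h, h'] with ε hε hε' x hx
  refine (norm_iteratedDeriv_mul_le (hu.smooth ε) (hv.smooth ε) (fun i hi => hε i hi x hx)
    (fun i hi => hε' i hi x hx)).trans_eq ?_
  have hpos := ε.pos.ne'
  rw [pow_add, inv_pow]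
  field_simp

theorem IsModerate.deriv {u : Net} (hu : IsModerate u) : IsModerate fun ε => deriv (u ε) :=
  ⟨fun ε => (contDiff_infty_iff_deriv.1 (hu.smooth ε)).2, fun K hK k => by
    simpa only [iteratedDeriv_succ'] using hu.bound K hK (k + 1)⟩

theorem IsNegligible.deriv {u : Net} (hu : IsNegligible u) : IsNegligible fun ε => deriv (u ε) :=
  ⟨fun ε => (contDiff_infty_iff_deriv.1 (hu.smooth ε)).2, fun K hK k => by
    simpa only [iteratedDeriv_succ'] using hu.bound K hK (k + 1)⟩

/-- The algebra `𝓔_M(ℝ)` of moderate nets, with componentwise operations. -/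
def moderate : Subalgebra ℂ Net where
  carrier := {u | IsModerate u}
  mul_mem' := IsModerate.mul
  add_mem' := IsModerate.add
  algebraMap_mem' c := isModerate_const (f := fun _ => c) contDiff_const

/-- The ideal `𝓝(ℝ)` of negligible nets. -/
def negligible : Ideal moderate where
  carrier := {u | IsNegligible (u : Net)}
  zero_mem' := isNegligible_zero
  add_mem' := IsNegligible.add
  smul_mem' c _ hu := IsNegligible.mul_left c.2 hu

/-- The special Colombeau algebra `𝓖(ℝ) = 𝓔_M(ℝ) / 𝓝(ℝ)`. -/
abbrev ColombeauAlgebra : Type := moderate ⧸ negligible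

/-- The class in `𝓖(ℝ)` of a moderate net. -/
def mk (u : Net) (hu : IsModerate u) : ColombeauAlgebra :=
  Ideal.Quotient.mk negligible ⟨u, hu⟩

/-- Componentwise differentiation of moderate nets. -/
def netDeriv : moderate →ₗ[ℂ] moderate where
  toFun u := ⟨fun ε => deriv ((u : Net) ε), IsModerate.deriv u.2⟩
  map_add' u v := by
    ext ε x
    exact deriv_add ((u.2.smooth ε).differentiable (by simp) x)
      ((v.2.smooth ε).differentiable (by simp) x)
  map_smul' c u := by
    ext ε x
    exact deriv_const_smul c ((u.2.smooth ε).differentiable (by simp) x)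

/-- Differentiation in `𝓖(ℝ)`, induced by componentwise differentiation. -/
def D : ColombeauAlgebra →ₗ[ℂ] ColombeauAlgebra :=
  (Submodule.Quotient.restrictScalarsEquiv ℂ negligible).toLinearMap ∘ₗ
    (Submodule.mapQ (negligible.restrictScalars ℂ) (negligible.restrictScalars ℂ) netDeriv
      fun _ hu => IsNegligible.deriv hu) ∘ₗ
    (Submodule.Quotient.restrictScalarsEquiv ℂ negligible).symm.toLinearMap

theorem D_mk (u : Net) (hu : IsModerate u) :
    D (mk u hu) = mk (fun ε => deriv (u ε)) hu.deriv := rfl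

/-- The embedding `f ↦ [(f)_ε]` of the smooth functions into `𝓖(ℝ)` as constant nets. -/
def ofSmooth (f : ℝ → ℂ) (hf : ContDiff ℝ ∞ f) : ColombeauAlgebra :=
  mk (fun _ => f) (isModerate_const hf)

/-- The coordinate function `x`, as an element of `𝓖(ℝ)`. -/
def X : ColombeauAlgebra := ofSmooth (fun x => (x : ℂ)) Complex.ofRealCLM.contDiff

/-- Association in `𝓖(ℝ)`: `u ≈ v` means that `∫ (u_ε - v_ε) φ dx → 0` as `ε → 0` for all test
functions `φ`, for some (equivalently, for all) representatives of `u` and `v`. -/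
def Assoc (u v : ColombeauAlgebra) : Prop :=
  ∃ (f g : Net) (hf : IsModerate f) (hg : IsModerate g), u = mk f hf ∧ v = mk g hg ∧
    ∀ φ : 𝓓((⊤ : TopologicalSpace.Opens ℝ), ℝ),
      Filter.Tendsto (fun ε => ∫ x, (f ε x - g ε x) * (φ x : ℂ)) epsZero (𝓝 0)

/-! ### Distributions on the real line and their embedding -/

/-- The space `𝓓(ℝ)` of real valued test functions on the line. -/
abbrev Test : Type := 𝓓((⊤ : TopologicalSpace.Opens ℝ), ℝ)

/-- The space `𝓓(ℝ, ℂ)` of complex valued test functions on the line. -/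
abbrev TestC : Type := 𝓓((⊤ : TopologicalSpace.Opens ℝ), ℂ)

/-- The space `𝓓'(ℝ)` of complex valued distributions on the line. -/
abbrev Distr : Type := 𝓓'((⊤ : TopologicalSpace.Opens ℝ), ℂ)

section Product

open ContDiffMapSupportedIn

/-- The product of a test function supported in `K` with a smooth function. -/
def mulSupported {f : ℝ → ℝ} (hf : ContDiff ℝ ∞ f) (K : TopologicalSpace.Compacts ℝ) :
    𝓓_{K}(ℝ, ℝ) →L[ℝ] 𝓓_{K}(ℝ, ℝ) :=
  ContDiffMapSupportedIn.mkCLM ℝ (fun φ x => f x * φ x)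
    (fun φ ψ x => by simp [mul_add])
    (fun c φ x => by simp; ring)
    (fun φ => hf.mul φ.contDiff)
    (fun φ x hx => by simp [φ.zero_on_compl hx])
    (by
      intro i _
      have hb : ∀ j : ℕ, ∃ C, ∀ x ∈ (K : Set ℝ), ‖iteratedFDeriv ℝ j f x‖ ≤ C := fun j =>
        K.isCompact.exists_bound_of_continuousOn
          (hf.continuous_iteratedFDeriv (by exact_mod_cast le_top)).continuousOn
      choose C hC using hb
      refine ⟨Finset.range (i + 1), ∑ j ∈ Finset.range (i + 1), (i.choose j : ℝ) * |C j|,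
        Finset.sum_nonneg fun j _ => by positivity, fun φ x hx => ?_⟩
      refine (norm_iteratedFDeriv_mul_le hf φ.contDiff x (by exact_mod_cast le_top)).trans ?_
      rw [Finset.sum_mul]
      refine Finset.sum_le_sum fun j hj => ?_
      have hj' : i - j ∈ Finset.range (i + 1) := Finset.mem_range.2 (by omega)
      gcongr
      · exact (hC j x hx).trans (le_abs_self _)
      · exact (norm_iteratedFDeriv_apply_le_seminorm_top ℝ).trans
          (Seminorm.le_finset_sup_apply hj'))

/-- The product of a test function with a smooth function. -/
def mulTest {f : ℝ → ℝ} (hf : ContDiff ℝ ∞ f) : Test →L[ℝ] Test :=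
  TestFunction.limitCLM ℝ
    (fun φ => ⟨fun x => f x * φ x, hf.mul φ.contDiff, φ.hasCompactSupport.mul_left,
      (tsupport_mul_subset_right (f := f) (g := φ)).trans φ.tsupport_subset⟩)
    (fun K hK => (TestFunction.ofSupportedInCLM ℝ hK).comp (mulSupported hf K))
    (fun _ _ _ => rfl)

@[simp]
theorem mulTest_apply {f : ℝ → ℝ} (hf : ContDiff ℝ ∞ f) (φ : Test) (x : ℝ) :
    mulTest hf φ x = f x * φ x := rfl

/-- The product `f w` of a distribution `w` with a smooth function `f`,
`⟨f w, φ⟩ = ⟨w, f φ⟩`. -/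
def mulDistr {f : ℝ → ℝ} (hf : ContDiff ℝ ∞ f) (w : Distr) : Distr :=
  (mulTest hf).precompCompactConvergenceCLM ℂ w

@[simp]
theorem mulDistr_apply {f : ℝ → ℝ} (hf : ContDiff ℝ ∞ f) (w : Distr) (φ : Test) :
    mulDistr hf w φ = w (mulTest hf φ) := rfl

end Product

/-- The complex linear extension of a distribution to complex valued test functions,
`⟨w, φ⟩ = ⟨w, Re φ⟩ + i ⟨w, Im φ⟩`. -/
def pairing (w : Distr) : TestC →L[ℝ] ℂ :=
  (show Test →L[ℝ] ℂ from w).comp (TestFunction.postcompCLM Complex.reCLM) +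
    Complex.I • (show Test →L[ℝ] ℂ from w).comp (TestFunction.postcompCLM Complex.imCLM)

theorem pairing_apply (w : Distr) (φ : TestC) :
    pairing w φ = w (TestFunction.postcompCLM Complex.reCLM φ) +
      Complex.I * w (TestFunction.postcompCLM Complex.imCLM φ) := rfl

/-- The complex valued test function `ψ h`, for a test function `ψ` and a smooth function `h`. -/
def cutoff (ψ : Test) (h : ℝ → ℂ) (hh : ContDiff ℝ ∞ h) : TestC :=
  ⟨fun y => (ψ y : ℂ) * h y, (Complex.ofRealCLM.contDiff.comp ψ.contDiff).mul hh,
    (ψ.hasCompactSupport.comp_left (g := ((↑) : ℝ → ℂ)) rfl).mul_right, fun _ _ => trivial⟩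

@[simp]
theorem cutoff_apply (ψ : Test) (h : ℝ → ℂ) (hh : ContDiff ℝ ∞ h) (y : ℝ) :
    cutoff ψ h hh y = (ψ y : ℂ) * h y := rfl

/-- A smooth function all of whose derivatives are bounded. -/
structure IsBddSmooth (g : ℝ → ℂ) : Prop where
  smooth : ContDiff ℝ ∞ g
  bound : ∀ k, ∃ M, ∀ x, ‖iteratedDeriv k g x‖ ≤ M

theorem IsBddSmooth.deriv {g : ℝ → ℂ} (hg : IsBddSmooth g) : IsBddSmooth (deriv g) :=
  ⟨(contDiff_infty_iff_deriv.1 hg.smooth).2, fun k => by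
    simpa only [iteratedDeriv_succ'] using hg.bound (k + 1)⟩

theorem IsBddSmooth.iteratedDeriv {g : ℝ → ℂ} (hg : IsBddSmooth g) (n : ℕ) :
    IsBddSmooth (iteratedDeriv n g) := by
  induction n with
  | zero => simpa using hg
  | succ n ih => rw [iteratedDeriv_succ]; exact ih.deriv

theorem contDiff_reflect {g : ℝ → ℂ} (hg : ContDiff ℝ ∞ g) (x : ℝ) :
    ContDiff ℝ ∞ fun y => g (x - y) :=
  hg.comp (contDiff_const.sub contDiff_id)

/-- The convolution `(ψ w) * g` of the compactly supported distribution `ψ w` with a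
smooth function `g`, that is `x ↦ ⟨w, ψ g(x - ·)⟩`. -/
def conv (w : Distr) (ψ : Test) (g : ℝ → ℂ) (hg : ContDiff ℝ ∞ g) : ℝ → ℂ :=
  fun x => pairing w (cutoff ψ (fun y => g (x - y)) (contDiff_reflect hg x))

/-- Continuity of a distribution on the test functions supported in a compact set. -/
theorem exists_bound (T : TestC →L[ℝ] ℂ) (K : TopologicalSpace.Compacts ℝ) :
    ∃ m : ℕ, ∃ C : ℝ, 0 ≤ C ∧ ∀ φ : TestC, tsupport φ ⊆ K → ∀ B : ℝ, 0 ≤ B →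
      (∀ k ≤ m, ∀ x ∈ (K : Set ℝ), ‖iteratedDeriv k φ x‖ ≤ B) → ‖T φ‖ ≤ C * B := by
  let S : 𝓓_{K}(ℝ, ℂ) →L[ℝ] ℂ := T.comp (TestFunction.ofSupportedInCLM ℝ (fun _ _ => trivial))
  obtain ⟨s, C, -, hC⟩ := Seminorm.bound_of_continuous
    (ContDiffMapSupportedIn.withSeminorms ℝ ℝ ℂ ⊤ K) ((normSeminorm ℝ ℂ).comp S.toLinearMap)
    (continuous_norm.comp S.continuous)
  refine ⟨s.sup id, C, C.2, fun φ hφ B hB h => ?_⟩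
  let φK : 𝓓_{K}(ℝ, ℂ) := .of_support_subset φ.contDiff (subset_closure.trans hφ)
  have h1 : ‖T φ‖ ≤ C * (s.sup fun i => ContDiffMapSupportedIn.seminorm ℝ ℝ ℂ ⊤ K i) φK := hC φK
  refine h1.trans ?_
  have h2 : (s.sup fun i => ContDiffMapSupportedIn.seminorm ℝ ℝ ℂ ⊤ K i) φK ≤ B := by
    refine Seminorm.finset_sup_apply_le hB fun i hi => ?_
    rw [ContDiffMapSupportedIn.seminorm_top_le_iff ℝ hB]
    intro x hx
    rw [norm_iteratedFDeriv_eq_norm_iteratedDeriv]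
    exact h i (Finset.le_sup (f := id) hi) x hx
  have := C.2
  gcongr

/-- `h ↦ ⟨w, ψ h⟩` is bounded by finitely many derivatives of `h` on a compact set. -/
theorem exists_bound_cutoff (w : Distr) (ψ : Test) :
    ∃ m : ℕ, ∃ C : ℝ, 0 ≤ C ∧ ∀ (h : ℝ → ℂ) (hh : ContDiff ℝ ∞ h) (B : ℝ), 0 ≤ B →
      (∀ k ≤ m, ∀ y, ‖iteratedDeriv k h y‖ ≤ B) → ‖pairing w (cutoff ψ h hh)‖ ≤ C * B := by
  obtain ⟨m, C, hC, hb⟩ := exists_bound (pairing w) ⟨tsupport ψ, ψ.hasCompactSupport⟩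
  have hψ : ContDiff ℝ ∞ fun y => (ψ y : ℂ) := Complex.ofRealCLM.contDiff.comp ψ.contDiff
  have hA' : ∃ A, 0 ≤ A ∧ ∀ i ≤ m, ∀ x ∈ tsupport ψ, ‖iteratedDeriv i (fun y => (ψ y : ℂ)) x‖ ≤ A := by
    choose A hA using fun k => ψ.hasCompactSupport.isCompact.exists_bound_of_continuousOn
      (hψ.continuous_iteratedDeriv k (by exact_mod_cast le_top)).continuousOn
    refine ⟨∑ i ∈ Finset.range (m + 1), |A i|, Finset.sum_nonneg fun _ _ => abs_nonneg _,
      fun i hi x hx => ?_⟩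
    exact (hA i x hx).trans ((le_abs_self _).trans (Finset.single_le_sum (f := fun i => |A i|)
      (fun _ _ => abs_nonneg _) (Finset.mem_range.2 (by omega))))
  obtain ⟨A, hA, hA'⟩ := hA'
  refine ⟨m, C * (2 ^ m * A), by positivity, fun h hh B hB hbound => ?_⟩
  have := hb (cutoff ψ h hh) ?_ (2 ^ m * (A * B)) (by positivity) ?_
  · exact this.trans_eq (by ring)
  · refine closure_mono fun y hy => ?_
    rw [Function.mem_support] at hy ⊢
    intro h0
    exact hy (by simp [h0])
  · intro k hk x hx
    refine (norm_iteratedDeriv_mul_le hψ hh (fun i hi => hA' i (hi.trans hk) x hx)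
      (fun i hi => hbound i (hi.trans hk) x)).trans ?_
    gcongr
    · norm_num

theorem norm_taylor_le {G : ℝ → ℂ} (hG : ContDiff ℝ ∞ G) {M : ℝ}
    (hM : ∀ x, ‖iteratedDeriv 2 G x‖ ≤ M) (a t : ℝ) :
    ‖G (a + t) - G a - t * deriv G a‖ ≤ M * |t| * |t| := by
  have hd : ContDiff ℝ ∞ (deriv G) := (contDiff_infty_iff_deriv.1 hG).2
  have hM' : ∀ x, ‖deriv (deriv G) x‖ ≤ M := fun x => by
    have := hM x
    rwa [iteratedDeriv_succ, iteratedDeriv_one] at this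
  have hM0 : 0 ≤ M := (norm_nonneg _).trans (hM 0)
  have hlip : ∀ s, ‖deriv G (a + s) - deriv G a‖ ≤ M * |s| := fun s => by
    simpa using convex_univ.norm_image_sub_le_of_norm_deriv_le
      (f := deriv G) (x := a) (y := a + s) (C := M)
      (fun x _ => hd.differentiable (by simp) x) (fun x _ => hM' x) trivial trivial
  have hder : ∀ s : ℝ, HasDerivAt (fun s : ℝ => G (a + s) - s * deriv G a)
      (deriv G (a + s) - deriv G a) s := fun s => by
    have h1 : HasDerivAt (fun s => G (a + s)) (deriv G (a + s)) s :=
      ((hG.differentiable (by simp) (a + s)).hasDerivAt).comp_const_add a s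
    have h2 : HasDerivAt (fun s : ℝ => (s : ℂ) * deriv G a) (1 * deriv G a) s :=
      (Complex.ofRealCLM.hasDerivAt (x := s)).mul_const _
    rw [one_mul] at h2
    exact h1.sub h2
  have := (convex_Icc (-|t|) |t|).norm_image_sub_le_of_norm_deriv_le
    (f := fun s : ℝ => G (a + s) - s * deriv G a) (x := 0) (y := t) (C := M * |t|)
    (fun s _ => (hder s).differentiableAt)
    (fun s hs => by
      rw [(hder s).deriv]
      refine (hlip s).trans ?_
      have : |s| ≤ |t| := abs_le.2 hs
      gcongr)
    ⟨by simp, by simp⟩ ⟨neg_abs_le t, le_abs_self t⟩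
  simp only [add_zero, Complex.ofReal_zero, zero_mul, sub_zero, Real.norm_eq_abs] at this
  rwa [show G (a + t) - G a - t * deriv G a = G (a + t) - t * deriv G a - G a by ring]

theorem pairing_cutoff_taylor (w : Distr) (ψ : Test) {g : ℝ → ℂ} (hg : IsBddSmooth g) (x t : ℝ) :
    conv w ψ g hg.smooth (x + t) - conv w ψ g hg.smooth x -
        t * conv w ψ (deriv g) hg.deriv.smooth x =
      pairing w (cutoff ψ (fun y => g (x + t - y) - g (x - y) - t * deriv g (x - y))
        (((contDiff_reflect hg.smooth (x + t)).sub (contDiff_reflect hg.smooth x)).sub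
          (contDiff_const.mul (contDiff_reflect hg.deriv.smooth x)))) := by
  unfold conv
  rw [← Complex.real_smul, ← map_smul, ← map_sub, ← map_sub]
  congr 1
  ext y
  simp [Complex.real_smul]
  ring

theorem iteratedDeriv_sub_sub_mul {f g h : ℝ → ℂ} (hf : ContDiff ℝ ∞ f) (hg : ContDiff ℝ ∞ g)
    (hh : ContDiff ℝ ∞ h) (c : ℂ) (k : ℕ) (y : ℝ) :
    iteratedDeriv k (fun y => f y - g y - c * h y) y =
      iteratedDeriv k f y - iteratedDeriv k g y - c * iteratedDeriv k h y := by
  have hch : ContDiff ℝ ∞ fun y => c * h y := contDiff_const.mul hh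
  have e : (fun y => f y - g y - c * h y) = (f - g) - fun y => c * h y := rfl
  have hfg : ContDiff ℝ ∞ (f - g) := hf.sub hg
  rw [e, iteratedDeriv_sub (contDiffAt_of_smooth hfg k y) (contDiffAt_of_smooth hch k y),
    iteratedDeriv_sub (contDiffAt_of_smooth hf k y) (contDiffAt_of_smooth hg k y),
    iteratedDeriv_const_mul _ (contDiffAt_of_smooth hh k y)]

theorem hasDerivAt_conv (w : Distr) (ψ : Test) {g : ℝ → ℂ} (hg : IsBddSmooth g) (x : ℝ) :
    HasDerivAt (conv w ψ g hg.smooth) (conv w ψ (deriv g) hg.deriv.smooth x) x := by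
  obtain ⟨m, C, hC, hb⟩ := exists_bound_cutoff w ψ
  choose M hM using hg.bound
  have hM0 : ∀ k, 0 ≤ M k := fun k => (norm_nonneg _).trans (hM k 0)
  set A : ℝ := ∑ i ∈ Finset.range (m + 1), M (i + 2) with hA
  have hA0 : 0 ≤ A := Finset.sum_nonneg fun _ _ => hM0 _
  have key : ∀ t : ℝ, ‖conv w ψ g hg.smooth (x + t) - conv w ψ g hg.smooth x -
      t • conv w ψ (deriv g) hg.deriv.smooth x‖ ≤ C * A * |t| * |t| := by
    intro t
    rw [Complex.real_smul, pairing_cutoff_taylor w ψ hg]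
    refine (hb _ _ (A * |t| * |t|) (by positivity) fun k hk y => ?_).trans_eq (by ring)
    have hs1 := contDiff_reflect hg.smooth (x + t)
    have hs2 := contDiff_reflect hg.smooth x
    have hs3 := contDiff_reflect hg.deriv.smooth x
    have e : iteratedDeriv k (fun y => g (x + t - y) - g (x - y) - t * deriv g (x - y)) y =
        (-1) ^ k * (iteratedDeriv k g (x - y + t) - iteratedDeriv k g (x - y) -
          t * deriv (iteratedDeriv k g) (x - y)) := by
      rw [iteratedDeriv_sub_sub_mul hs1 hs2 hs3,
        iteratedDeriv_comp_const_sub, iteratedDeriv_comp_const_sub, iteratedDeriv_comp_const_sub]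
      simp only [← iteratedDeriv_succ', iteratedDeriv_succ, Complex.real_smul]
      rw [show x + t - y = x - y + t by ring]
      push_cast
      ring
    rw [e, norm_mul, norm_pow, norm_neg, norm_one, one_pow, one_mul]
    refine (norm_taylor_le (hg.iteratedDeriv k).smooth (M := M (k + 2)) (fun z => ?_) _ _).trans ?_
    · have : iteratedDeriv 2 (iteratedDeriv k g) z = iteratedDeriv (k + 2) g z := by
        simp [iteratedDeriv_succ]
      rw [this]
      exact hM _ _
    · gcongr
      exact Finset.single_le_sum (f := fun i => M (i + 2)) (fun _ _ => hM0 _)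
        (Finset.mem_range.2 (by omega))
  rw [hasDerivAt_iff_isLittleO_nhds_zero]
  refine Asymptotics.IsBigO.trans_isLittleO (g := fun t : ℝ => t * t) ?_ ?_
  · refine Asymptotics.IsBigO.of_bound (C * A) (Filter.Eventually.of_forall fun t => ?_)
    rw [norm_mul, Real.norm_eq_abs, ← mul_assoc]
    exact key t
  · simpa [pow_two] using (Asymptotics.isLittleO_pow_id (𝕜 := ℝ) (n := 2) (by norm_num))

theorem iteratedDeriv_conv (w : Distr) (ψ : Test) {g : ℝ → ℂ} (hg : IsBddSmooth g) (n : ℕ) :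
    iteratedDeriv n (conv w ψ g hg.smooth) =
      conv w ψ (iteratedDeriv n g) (hg.iteratedDeriv n).smooth := by
  induction n with
  | zero => ext x; simp only [iteratedDeriv_zero]
  | succ n ih =>
    rw [iteratedDeriv_succ, ih]
    ext x
    rw [(hasDerivAt_conv w ψ (hg.iteratedDeriv n) x).deriv]
    simp only [← iteratedDeriv_succ]

theorem contDiff_conv (w : Distr) (ψ : Test) {g : ℝ → ℂ} (hg : IsBddSmooth g) :
    ContDiff ℝ ∞ (conv w ψ g hg.smooth) := by
  refine contDiff_of_differentiable_iteratedDeriv fun n _ => ?_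
  rw [iteratedDeriv_conv w ψ hg]
  exact fun x => (hasDerivAt_conv w ψ (hg.iteratedDeriv n) x).differentiableAt

/-- The scaled mollifier `ρ_ε(x) = ε⁻¹ ρ(x / ε)`. -/
def scaled (ρ : 𝓢(ℝ, ℂ)) (ε : Eps) : ℝ → ℂ := fun x => ((ε : ℝ)⁻¹ : ℝ) • ρ (x / ε)

theorem contDiff_scaled (ρ : 𝓢(ℝ, ℂ)) (ε : Eps) : ContDiff ℝ ∞ (scaled ρ ε) :=
  ((ρ.smooth ⊤).comp (contDiff_id.div_const _)).const_smul ((ε : ℝ)⁻¹)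

theorem iteratedDeriv_scaled (ρ : 𝓢(ℝ, ℂ)) (ε : Eps) (k : ℕ) (x : ℝ) :
    iteratedDeriv k (scaled ρ ε) x =
      (((ε : ℝ)⁻¹) ^ (k + 1) : ℝ) • iteratedDeriv k ρ (x / ε) := by
  have h1 : scaled ρ ε = (ε : ℝ)⁻¹ • fun x => ρ ((ε : ℝ)⁻¹ * x) := by
    ext y
    simp [scaled, div_eq_inv_mul]
  have hs : ContDiff ℝ k ρ := (ρ.smooth k)
  have hs' : ContDiff ℝ k fun x => ρ ((ε : ℝ)⁻¹ * x) := hs.comp (contDiff_const.mul contDiff_id)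
  rw [h1, iteratedDeriv_const_smul hs'.contDiffAt]
  have h2 := iteratedDeriv_comp_const_smul hs (ε : ℝ)⁻¹
  have h3 := congrFun h2 x
  rw [h3, smul_smul, pow_succ', div_eq_inv_mul]

theorem exists_bound_scaled (ρ : 𝓢(ℝ, ℂ)) (k : ℕ) :
    ∃ M : ℝ, 0 ≤ M ∧ ∀ (ε : Eps) (x : ℝ),
      ‖iteratedDeriv k (scaled ρ ε) x‖ ≤ M * ((ε : ℝ)⁻¹) ^ (k + 1) := by
  obtain ⟨M, hM0, hM⟩ := ρ.decay 0 k
  refine ⟨M, hM0.le, fun ε x => ?_⟩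
  have hpos := ε.pos
  rw [iteratedDeriv_scaled, norm_smul, Real.norm_of_nonneg (by positivity), mul_comm]
  gcongr
  simpa [norm_iteratedFDeriv_eq_norm_iteratedDeriv] using hM (x / ε)

theorem isBddSmooth_scaled (ρ : 𝓢(ℝ, ℂ)) (ε : Eps) : IsBddSmooth (scaled ρ ε) :=
  ⟨contDiff_scaled ρ ε, fun k => by
    obtain ⟨M, -, hM⟩ := exists_bound_scaled ρ k
    exact ⟨_, hM ε⟩⟩

/-- The net `((ψ w) * ρ_ε)_ε` is moderate. -/
theorem isModerate_conv (ρ : 𝓢(ℝ, ℂ)) (w : Distr) (ψ : Test) :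
    IsModerate fun ε => conv w ψ (scaled ρ ε) (contDiff_scaled ρ ε) := by
  refine ⟨fun ε => contDiff_conv w ψ (isBddSmooth_scaled ρ ε), fun K _ n => ?_⟩
  obtain ⟨m, C, hC, hb⟩ := exists_bound_cutoff w ψ
  choose M hM0 hM using exists_bound_scaled ρ
  refine ⟨m + n + 1, C * ∑ k ∈ Finset.range (m + 1), M (k + n), Filter.Eventually.of_forall
    fun ε x _ => ?_⟩
  have hpos := ε.pos
  have hinv := ε.one_le_inv
  rw [iteratedDeriv_conv w ψ (isBddSmooth_scaled ρ ε), mul_assoc]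
  have hS0 : 0 ≤ ∑ k ∈ Finset.range (m + 1), M (k + n) := Finset.sum_nonneg fun _ _ => hM0 _
  refine hb _ _ _ (by positivity) fun k hk y => ?_
  have e : iteratedDeriv k (fun y => iteratedDeriv n (scaled ρ ε) (x - y)) y =
      (-1) ^ k * iteratedDeriv (k + n) (scaled ρ ε) (x - y) := by
    rw [iteratedDeriv_comp_const_sub]
    simp only [iteratedDeriv_eq_iterate, ← Function.iterate_add_apply]
    simp
  rw [e, norm_mul, norm_pow, norm_neg, norm_one, one_pow, one_mul]
  refine (hM (k + n) ε (x - y)).trans ?_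
  gcongr
  · exact Finset.single_le_sum (f := fun k => M (k + n)) (fun _ _ => hM0 _)
      (Finset.mem_range.2 (by omega))

/-- A Schwartz mollifier: it has integral one and all its higher moments vanish. -/
structure IsMollifier (ρ : 𝓢(ℝ, ℂ)) : Prop where
  integral_eq_one : ∫ x, ρ x = 1
  moment_eq_zero : ∀ k : ℕ, 1 ≤ k → ∫ x : ℝ, (x : ℂ) ^ k * ρ x = 0

/-- The auxiliary data in the construction of the embedding: a covering of the line by relatively
compact open sets `U j`, a smooth partition of unity `χ j` subordinate to it, and test functions
`ψ j` that are equal to one in a neighborhood of the closure of `U j`. -/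
structure Localization (J : Type*) where
  /-- The covering. -/
  U : J → Set ℝ
  isOpen_U : ∀ j, IsOpen (U j)
  isCompact_closure_U : ∀ j, IsCompact (closure (U j))
  iUnion_U : ⋃ j, U j = Set.univ
  /-- The partition of unity. -/
  χ : SmoothPartitionOfUnity J 𝓘(ℝ, ℝ) ℝ Set.univ
  isSubordinate : χ.IsSubordinate U
  /-- The cut-off functions. -/
  ψ : J → Test
  ψ_eq_one : ∀ j, ∀ᶠ x in 𝓝ˢ (closure (U j)), ψ j x = 1

/-- The net `u_ε = ∑ j, χ j ((ψ j w) * ρ_ε)` representing the distribution `w`. The sum is locally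
finite. -/
def embedNet {J : Type*} (ρ : 𝓢(ℝ, ℂ)) (P : Localization J) (w : Distr) : Net :=
  fun ε x => ∑ᶠ j, (P.χ j x : ℂ) * conv w (P.ψ j) (scaled ρ ε) (contDiff_scaled ρ ε) x

theorem embedNet_eq_sum {J : Type*} (ρ : 𝓢(ℝ, ℂ)) (P : Localization J) (w : Distr)
    {K : Set ℝ} (hK : IsCompact K) :
    ∃ v : Net, IsModerate v ∧ ∀ ε, ∀ x ∈ K, embedNet ρ P w ε =ᶠ[𝓝 x] v ε := by
  have hK' : IsCompact (Metric.cthickening 1 K) := hK.cthickening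
  have hfin := P.χ.locallyFinite.finite_nonempty_inter_compact hK'
  let f : J → Net := fun j ε x =>
    (P.χ j x : ℂ) * conv w (P.ψ j) (scaled ρ ε) (contDiff_scaled ρ ε) x
  have hf : ∀ j, IsModerate (f j) := fun j => by
    have hχ : ContDiff ℝ ∞ fun x => (P.χ j x : ℂ) :=
      Complex.ofRealCLM.contDiff.comp (contMDiff_iff_contDiff.1 (P.χ j).contMDiff)
    exact (isModerate_const hχ).mul (isModerate_conv ρ w (P.ψ j))
  refine ⟨∑ j ∈ hfin.toFinset, f j, Subalgebra.sum_mem moderate fun j _ => hf j,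
    fun ε x hx => ?_⟩
  have hnhds : Metric.thickening 1 K ∈ 𝓝 x :=
    Metric.isOpen_thickening.mem_nhds (Metric.self_subset_thickening one_pos K hx)
  filter_upwards [hnhds] with y hy
  rw [Finset.sum_apply, Finset.sum_apply]
  refine finsum_eq_sum_of_support_subset _ fun j hj => ?_
  simp only [Set.Finite.coe_toFinset, Set.mem_ofPred_eq]
  refine ⟨y, fun h0 => hj ?_, Metric.thickening_subset_cthickening 1 K hy⟩
  simp [h0]

theorem isModerate_embedNet {J : Type*} (ρ : 𝓢(ℝ, ℂ)) (P : Localization J) (w : Distr) :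
    IsModerate (embedNet ρ P w) := by
  refine ⟨fun ε => contDiff_iff_contDiffAt.2 fun x => ?_, fun K hK k => ?_⟩
  · obtain ⟨v, hv, h⟩ := embedNet_eq_sum ρ P w (isCompact_singleton (x := x))
    exact (hv.smooth ε).contDiffAt.congr_of_eventuallyEq (h ε x rfl)
  · obtain ⟨v, hv, h⟩ := embedNet_eq_sum ρ P w hK
    obtain ⟨N, C, hC⟩ := hv.bound K hK k
    refine ⟨N, C, hC.mono fun ε hε x hx => ?_⟩
    rw [(h ε x hx).iteratedDeriv_eq k]
    exact hε x hx

/-- The embedding `ι : 𝓓'(ℝ) → 𝓖(ℝ)` determined by a mollifier `ρ`, computed with the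
localization data `P`. -/
def embed {J : Type*} (ρ : 𝓢(ℝ, ℂ)) (P : Localization J) (w : Distr) : ColombeauAlgebra :=
  mk (embedNet ρ P w) (isModerate_embedNet ρ P w)

end Colombeau

end

/-!
Fix `w ∈ 𝓓'(ℝ)` and a cut-off `ψ`. Since `ψ w` has finite order, `h ↦ ⟨w, ψ h⟩` depends continuously
on finitely many derivatives of the bounded smooth function `h` in the supremum norm, so by
Hahn–Banach it is the restriction of a continuous linear functional on a Banach space, and therefore
commutes with Bochner integrals of such `h`. Applied to reflected translates, this gives
`∫ ((ψ w) * ρ_ε) φ = ∫ ((ψ w) * φ̌) ρ̌_ε`, where `ǧ(x) = g(-x)`. The function `(ψ w) * φ̌` is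
continuous and bounded, so the right-hand side tends to `((ψ w) * φ̌)(0) = ⟨w, ψ φ⟩`. Summing over
the partition of unity, the net `ι(w)_ε` converges weakly to `w`. Weak limits of nets are compatible
with differentiation and with multiplication by smooth functions, and negligible nets tend to zero,
so two Colombeau functions with distributional limits are associated exactly when their limits
agree.
-/

namespace Colombeau

open MeasureTheory Filter
open scoped BoundedContinuousFunction

theorem exists_comp_eq_of_norm_le {𝕜 V E F : Type*} [RCLike 𝕜] [AddCommGroup V] [Module 𝕜 V]
    [NormedAddCommGroup E] [NormedSpace 𝕜 E] [NormedAddCommGroup F] [NormedSpace 𝕜 F]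
    [FiniteDimensional 𝕜 F] (j : V →ₗ[𝕜] E) (T : V →ₗ[𝕜] F) (C : ℝ)
    (hT : ∀ v, ‖T v‖ ≤ C * ‖j v‖) : ∃ L : E →L[𝕜] F, ∀ v, L (j v) = T v := by
  have hker : j.ker ≤ T.ker := fun v hv => by
    simpa [LinearMap.mem_ker.1 hv] using hT v
  let S : j.range →ₗ[𝕜] F := (j.ker.liftQ T hker).comp j.quotKerEquivRange.symm.toLinearMap
  have hS (v : V) : S ⟨j v, v, rfl⟩ = T v :=
    congrArg (j.ker.liftQ T hker) (j.quotKerEquivRange_symm_apply_image v ⟨v, rfl⟩)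
  obtain ⟨L, hL⟩ := (S.mkContinuous C <| by
    rintro ⟨-, v, rfl⟩
    exact (hS v).symm ▸ hT v).exist_extension_of_finiteDimensional_range
  exact ⟨L, fun v => (congrArg (fun M => M ⟨j v, v, rfl⟩) hL).symm.trans (hS v)⟩

/-! ### Bounded smooth functions -/

theorem IsBddSmooth.add {f g : ℝ → ℂ} (hf : IsBddSmooth f) (hg : IsBddSmooth g) :
    IsBddSmooth (f + g) := by
  refine ⟨hf.smooth.add hg.smooth, fun k => ?_⟩
  obtain ⟨M, hM⟩ := hf.bound k
  obtain ⟨N, hN⟩ := hg.bound k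
  refine ⟨M + N, fun x => ?_⟩
  rw [iteratedDeriv_add (contDiffAt_of_smooth hf.smooth k x) (contDiffAt_of_smooth hg.smooth k x)]
  exact norm_add_le_of_le (hM x) (hN x)

theorem IsBddSmooth.const_smul {f : ℝ → ℂ} (c : ℂ) (hf : IsBddSmooth f) :
    IsBddSmooth (c • f) := by
  refine ⟨contDiff_const.smul hf.smooth, fun k => ?_⟩
  obtain ⟨M, hM⟩ := hf.bound k
  refine ⟨‖c‖ * M, fun x => ?_⟩
  rw [iteratedDeriv_const_smul (contDiffAt_of_smooth hf.smooth k x), norm_smul]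
  gcongr
  exact hM x

theorem isBddSmooth_zero : IsBddSmooth 0 :=
  ⟨contDiff_const, fun k => ⟨0, fun x => by simp⟩⟩

/-- The space of smooth functions all of whose derivatives are bounded. -/
def bddSmooth : Submodule ℂ (ℝ → ℂ) where
  carrier := {f | IsBddSmooth f}
  add_mem' := .add
  zero_mem' := isBddSmooth_zero
  smul_mem' c _ := .const_smul c

instance : CoeFun bddSmooth fun _ => ℝ → ℂ := ⟨Subtype.val⟩

theorem isBddSmooth_coe (f : bddSmooth) : IsBddSmooth f := f.2

/-- The `k`-th derivative, as a map into the Banach space of bounded continuous functions. -/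
noncomputable def derivBCF (k : ℕ) : bddSmooth →ₗ[ℂ] ℝ →ᵇ ℂ where
  toFun f := .ofNormedAddCommGroup (iteratedDeriv k (f : ℝ → ℂ))
    ((isBddSmooth_coe f).iteratedDeriv k).smooth.continuous
    ((isBddSmooth_coe f).bound k).choose ((isBddSmooth_coe f).bound k).choose_spec
  map_add' f g := by
    ext x
    exact iteratedDeriv_add (contDiffAt_of_smooth (isBddSmooth_coe f).smooth k x)
      (contDiffAt_of_smooth (isBddSmooth_coe g).smooth k x)
  map_smul' c f := by
    ext x
    exact iteratedDeriv_const_smul (contDiffAt_of_smooth (isBddSmooth_coe f).smooth k x) c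

@[simp]
theorem derivBCF_apply (k : ℕ) (f : bddSmooth) (x : ℝ) :
    derivBCF k f x = iteratedDeriv k (f : ℝ → ℂ) x := rfl

/-- The derivatives of order at most `m`, measured in the supremum norm. -/
noncomputable def jet (m : ℕ) : bddSmooth →ₗ[ℂ] (Fin (m + 1) → ℝ →ᵇ ℂ) :=
  LinearMap.pi fun k => derivBCF k

theorem norm_derivBCF_le_norm_jet {m k : ℕ} (hk : k ≤ m) (f : bddSmooth) :
    ‖derivBCF k f‖ ≤ ‖jet m f‖ :=
  norm_le_pi_norm (jet m f) ⟨k, Nat.lt_succ_of_le hk⟩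

/-! ### Distributions of compact support acting on bounded smooth functions -/

theorem pairing_smul (w : Distr) (c : ℂ) (φ : TestC) : pairing w (c • φ) = c * pairing w φ := by
  have hre : TestFunction.postcompCLM Complex.reCLM (c • φ) =
      c.re • TestFunction.postcompCLM Complex.reCLM φ -
        c.im • TestFunction.postcompCLM Complex.imCLM φ := by
    ext x
    simp
  have him : TestFunction.postcompCLM Complex.imCLM (c • φ) =
      c.re • TestFunction.postcompCLM Complex.imCLM φ +
        c.im • TestFunction.postcompCLM Complex.reCLM φ := by
    ext x
    simp
  simp only [pairing_apply, hre, him, map_sub, map_add, map_smul, Complex.real_smul]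
  set a := w (TestFunction.postcompCLM Complex.reCLM φ)
  set b := w (TestFunction.postcompCLM Complex.imCLM φ)
  linear_combination (a + Complex.I * b) * Complex.re_add_im c - c.im * b * Complex.I_sq

/-- The functional `h ↦ ⟨w, ψ h⟩`, that is the distribution `ψ w` of compact support applied to
functions which need not have compact support. -/
noncomputable def pairingCutoff (w : Distr) (ψ : Test) : bddSmooth →ₗ[ℂ] ℂ where
  toFun h := pairing w (cutoff ψ h (isBddSmooth_coe h).smooth)
  map_add' h₁ h₂ := by
    rw [← map_add]
    congr 1
    ext y
    simp [mul_add]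
  map_smul' c h := by
    rw [RingHom.id_apply, smul_eq_mul, ← pairing_smul]
    congr 1
    ext y
    simp [mul_left_comm]

theorem pairingCutoff_apply (w : Distr) (ψ : Test) (h : bddSmooth) :
    pairingCutoff w ψ h = pairing w (cutoff ψ h (isBddSmooth_coe h).smooth) := rfl

theorem exists_pairingCutoff_eq_jet (w : Distr) (ψ : Test) :
    ∃ m, ∃ L : (Fin (m + 1) → ℝ →ᵇ ℂ) →L[ℂ] ℂ, ∀ h, L (jet m h) = pairingCutoff w ψ h := by
  obtain ⟨m, C, -, hC⟩ := exists_bound_cutoff w ψ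
  exact ⟨m, exists_comp_eq_of_norm_le (jet m) (pairingCutoff w ψ) C fun h =>
    hC h (isBddSmooth_coe h).smooth _ (norm_nonneg _) fun k hk y =>
      ((derivBCF k h).norm_coe_le_norm y).trans (norm_derivBCF_le_norm_jet hk h)⟩

section Integral

variable {X : Type*} [MeasurableSpace X] {μ : Measure X} {F : X → bddSmooth}

theorem integrable_iteratedDeriv {k : ℕ} (hF : Integrable (fun x => derivBCF k (F x)) μ) (y : ℝ) :
    Integrable (fun x => iteratedDeriv k (F x : ℝ → ℂ) y) μ :=
  (BoundedContinuousFunction.evalCLM ℂ y).integrable_comp hF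

theorem integral_derivBCF_apply {k : ℕ} (hF : Integrable (fun x => derivBCF k (F x)) μ) (y : ℝ) :
    (∫ x, derivBCF k (F x) ∂μ) y = ∫ x, iteratedDeriv k (F x : ℝ → ℂ) y ∂μ :=
  ((BoundedContinuousFunction.evalCLM ℂ y).integral_comp_comm hF).symm

theorem hasDerivAt_integral_iteratedDeriv (hF : ∀ k, Integrable (fun x => derivBCF k (F x)) μ)
    (k : ℕ) (y : ℝ) : HasDerivAt (fun y => ∫ x, iteratedDeriv k (F x : ℝ → ℂ) y ∂μ)
      (∫ x, iteratedDeriv (k + 1) (F x : ℝ → ℂ) y ∂μ) y := by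
  refine (hasDerivAt_integral_of_dominated_loc_of_deriv_le univ_mem
    (Eventually.of_forall fun z => (integrable_iteratedDeriv (hF k) z).aestronglyMeasurable)
    (integrable_iteratedDeriv (hF k) y)
    (integrable_iteratedDeriv (hF (k + 1)) y).aestronglyMeasurable
    (Eventually.of_forall fun x z _ => (derivBCF (k + 1) (F x)).norm_coe_le_norm z)
    (hF (k + 1)).norm (Eventually.of_forall fun x z _ => ?_)).2
  rw [derivBCF_apply, iteratedDeriv_succ]
  exact (((isBddSmooth_coe (F x)).iteratedDeriv k).smooth.differentiable (by simp) z).hasDerivAt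

theorem iteratedDeriv_integral (hF : ∀ k, Integrable (fun x => derivBCF k (F x)) μ) (k : ℕ) :
    iteratedDeriv k (fun y => ∫ x, F x y ∂μ) =
      fun y => ∫ x, iteratedDeriv k (F x : ℝ → ℂ) y ∂μ := by
  induction k with
  | zero => simp
  | succ k ih =>
    ext y
    rw [iteratedDeriv_succ, ih, (hasDerivAt_integral_iteratedDeriv hF k y).deriv]

theorem isBddSmooth_integral (hF : ∀ k, Integrable (fun x => derivBCF k (F x)) μ) :
    IsBddSmooth fun y => ∫ x, F x y ∂μ where
  smooth := contDiff_of_differentiable_iteratedDeriv fun k _ => by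
    rw [iteratedDeriv_integral hF]
    exact fun y => (hasDerivAt_integral_iteratedDeriv hF k y).differentiableAt
  bound k := ⟨‖∫ x, derivBCF k (F x) ∂μ‖, fun y => by
    rw [congrFun (iteratedDeriv_integral hF k) y, ← integral_derivBCF_apply (hF k)]
    exact BoundedContinuousFunction.norm_coe_le_norm _ y⟩

/-- The integral of a family of bounded smooth functions. -/
noncomputable def bddIntegral (hF : ∀ k, Integrable (fun x => derivBCF k (F x)) μ) : bddSmooth :=
  ⟨fun y => ∫ x, F x y ∂μ, isBddSmooth_integral hF⟩

theorem derivBCF_bddIntegral (hF : ∀ k, Integrable (fun x => derivBCF k (F x)) μ) (k : ℕ) :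
    derivBCF k (bddIntegral hF) = ∫ x, derivBCF k (F x) ∂μ := by
  ext y
  rw [integral_derivBCF_apply (hF k)]
  exact congrFun (iteratedDeriv_integral hF k) y

theorem jet_bddIntegral (hF : ∀ k, Integrable (fun x => derivBCF k (F x)) μ) (m : ℕ) :
    jet m (bddIntegral hF) = ∫ x, jet m (F x) ∂μ :=
  funext fun k => (derivBCF_bddIntegral hF k).trans
    (eval_integral (fun i : Fin (m + 1) => hF i) k).symm

theorem pairingCutoff_bddIntegral (hF : ∀ k, Integrable (fun x => derivBCF k (F x)) μ)
    (w : Distr) (ψ : Test) :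
    pairingCutoff w ψ (bddIntegral hF) = ∫ x, pairingCutoff w ψ (F x) ∂μ := by
  obtain ⟨m, L, hL⟩ := exists_pairingCutoff_eq_jet w ψ
  simp_rw [← hL, jet_bddIntegral hF]
  exact (L.integral_comp_comm (Integrable.of_eval fun k : Fin (m + 1) => hF k)).symm

end Integral

/-- The reflected translate `y ↦ g (x - y)`. -/
def reflect (g : bddSmooth) (x : ℝ) : bddSmooth where
  val y := g (x - y)
  property := ⟨contDiff_reflect (isBddSmooth_coe g).smooth x, fun k => ⟨‖derivBCF k g‖, fun y => by
    rw [iteratedDeriv_comp_const_sub, norm_smul, norm_pow, norm_neg, norm_one, one_pow, one_mul]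
    exact (derivBCF k g).norm_coe_le_norm (x - y)⟩⟩

theorem conv_eq_pairingCutoff (w : Distr) (ψ : Test) (g : bddSmooth) (x : ℝ) :
    conv w ψ g (isBddSmooth_coe g).smooth x = pairingCutoff w ψ (reflect g x) := rfl

theorem derivBCF_reflect_apply (k : ℕ) (g : bddSmooth) (x y : ℝ) :
    derivBCF k (reflect g x) y = (-1 : ℝ) ^ k • derivBCF k g (x - y) :=
  congrFun (iteratedDeriv_comp_const_sub ..) y

theorem norm_derivBCF_reflect_le (k : ℕ) (g : bddSmooth) (x : ℝ) :
    ‖derivBCF k (reflect g x)‖ ≤ ‖derivBCF k g‖ := by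
  refine BoundedContinuousFunction.norm_le_of_nonempty.2 fun y => ?_
  rw [derivBCF_reflect_apply, norm_smul, norm_pow, norm_neg, norm_one, one_pow, one_mul]
  exact (derivBCF k g).norm_coe_le_norm (x - y)

theorem lipschitzWith_derivBCF (k : ℕ) (g : bddSmooth) :
    LipschitzWith ‖derivBCF (k + 1) g‖₊ (derivBCF k g) := by
  refine lipschitzWith_of_nnnorm_deriv_le
    (((isBddSmooth_coe g).iteratedDeriv k).smooth.differentiable (by simp)) fun x => ?_
  change ‖deriv (iteratedDeriv k (g : ℝ → ℂ)) x‖₊ ≤ _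
  rw [← iteratedDeriv_succ]
  exact (derivBCF (k + 1) g).nnnorm_coe_le_nnnorm x

theorem continuous_derivBCF_reflect (k : ℕ) (g : bddSmooth) :
    Continuous fun x => derivBCF k (reflect g x) := by
  refine (LipschitzWith.of_dist_le_mul (K := ‖derivBCF (k + 1) g‖₊) fun x x' => ?_).continuous
  refine (BoundedContinuousFunction.dist_le (by positivity)).2 fun y => ?_
  rw [derivBCF_reflect_apply, derivBCF_reflect_apply, dist_smul₀, norm_pow, norm_neg, norm_one,
    one_pow, one_mul, ← dist_sub_right x x' y]
  exact (lipschitzWith_derivBCF k g).dist_le_mul _ _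

theorem integrable_derivBCF_smul_reflect {κ : ℝ → ℂ} (hκ : Integrable κ) (g : bddSmooth) (k : ℕ) :
    Integrable fun x => derivBCF k (κ x • reflect g x) := by
  simp_rw [map_smul]
  exact hκ.smul_bdd _ (continuous_derivBCF_reflect k g).aestronglyMeasurable
    (Eventually.of_forall (norm_derivBCF_reflect_le k g))

theorem integral_conv_mul (w : Distr) (ψ : Test) (g : bddSmooth) {κ : ℝ → ℂ}
    (hκ : Integrable κ) : ∫ x, conv w ψ g (isBddSmooth_coe g).smooth x * κ x =
      pairingCutoff w ψ (bddIntegral (integrable_derivBCF_smul_reflect hκ g)) := by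
  simp_rw [pairingCutoff_bddIntegral, map_smul, smul_eq_mul, mul_comm (κ _), conv_eq_pairingCutoff]

theorem integral_conv_mul_comm (w : Distr) (ψ : Test) (f g : bddSmooth)
    (hf : Integrable (f : ℝ → ℂ)) (hg : Integrable (g : ℝ → ℂ)) :
    ∫ x, conv w ψ g (isBddSmooth_coe g).smooth x * f (-x) =
      ∫ x, conv w ψ f (isBddSmooth_coe f).smooth x * g (-x) := by
  rw [integral_conv_mul w ψ g hf.comp_neg, integral_conv_mul w ψ f hg.comp_neg]
  refine congrArg (pairingCutoff w ψ) (Subtype.ext (funext fun y => ?_))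
  calc ∫ x, f (-x) * g (x - y)
      = ∫ x, f (-(y - x)) * g (y - x - y) :=
        (integral_sub_left_eq_self (fun x => f (-x) * g (x - y)) volume y).symm
    _ = ∫ x, g (-x) * f (x - y) := by simp [mul_comm]

theorem exists_norm_conv_le (w : Distr) (ψ : Test) (g : bddSmooth) :
    ∃ M, ∀ x, ‖conv w ψ g (isBddSmooth_coe g).smooth x‖ ≤ M := by
  obtain ⟨m, L, hL⟩ := exists_pairingCutoff_eq_jet w ψ
  refine ⟨‖L‖ * ‖jet m g‖, fun x => ?_⟩
  rw [conv_eq_pairingCutoff, ← hL]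
  refine L.le_opNorm_of_le ((pi_norm_le_iff_of_nonneg (norm_nonneg _)).2 fun k => ?_)
  exact (norm_derivBCF_reflect_le k g x).trans (norm_le_pi_norm (jet m g) k)

theorem Test.contDiff_ofReal (φ : Test) : ContDiff ℝ ∞ fun x => (φ x : ℂ) :=
  Complex.ofRealCLM.contDiff.comp φ.contDiff

theorem Test.hasCompactSupport_ofReal (φ : Test) : HasCompactSupport fun x => (φ x : ℂ) :=
  φ.hasCompactSupport.comp_left (g := ((↑) : ℝ → ℂ)) rfl

theorem Test.integrable_mul {f : ℝ → ℂ} (hf : Continuous f) (φ : Test) :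
    Integrable fun x => f x * (φ x : ℂ) :=
  (hf.mul φ.contDiff_ofReal.continuous).integrable_of_hasCompactSupport
    φ.hasCompactSupport_ofReal.mul_left

theorem Test.integrable_ofReal (φ : Test) : Integrable fun x => (φ x : ℂ) := by
  simpa using φ.integrable_mul (f := 1) continuous_const

theorem IsBddSmooth.of_hasCompactSupport {f : ℝ → ℂ} (hf : ContDiff ℝ ∞ f)
    (hc : HasCompactSupport f) : IsBddSmooth f := by
  refine ⟨hf, fun k => ?_⟩
  have hs : HasCompactSupport (_root_.iteratedDeriv k f) := by
    induction k with
    | zero => simpa using hc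
    | succ k ih => rw [iteratedDeriv_succ]; exact ih.deriv
  exact hs.exists_bound_of_continuous (hf.continuous_iteratedDeriv k (by exact_mod_cast le_top))

/-- A real test function as a bounded smooth function with complex values. -/
noncomputable def Test.toBddSmooth (φ : Test) : bddSmooth :=
  ⟨fun x => φ x, .of_hasCompactSupport φ.contDiff_ofReal φ.hasCompactSupport_ofReal⟩

theorem pairingCutoff_toBddSmooth (w : Distr) (ψ φ : Test) :
    pairingCutoff w ψ φ.toBddSmooth = mulDistr ψ.contDiff w φ := by
  set h := φ.toBddSmooth with hdef
  have hre : TestFunction.postcompCLM Complex.reCLM (cutoff ψ h (isBddSmooth_coe h).smooth) =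
      mulTest ψ.contDiff φ := by
    ext y
    simp [hdef, Test.toBddSmooth]
  have him : TestFunction.postcompCLM Complex.imCLM (cutoff ψ h (isBddSmooth_coe h).smooth) =
      (0 : Test) := by
    ext y
    simp [hdef, Test.toBddSmooth]
  rw [pairingCutoff_apply, pairing_apply, hre, him, map_zero, mul_zero, add_zero, mulDistr_apply]

/-! ### Regularisation by a mollifier -/

theorem tendsto_val_epsZero : Tendsto (fun ε : Eps => (ε : ℝ)) epsZero (𝓝 0) := tendsto_comap

instance : epsZero.NeBot := by
  refine comap_neBot fun t ht => ?_
  have h : t ∩ Set.Ioc 0 1 ∈ 𝓝[>] (0 : ℝ) :=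
    inter_mem (mem_nhdsWithin_of_mem_nhds ht) (Ioc_mem_nhdsGT one_pos)
  obtain ⟨x, hx⟩ := nonempty_of_mem h
  exact ⟨⟨x, hx.2⟩, hx.1⟩

instance : epsZero.IsCountablyGenerated := by
  unfold epsZero; infer_instance

theorem integral_mul_scaled_neg (ρ : 𝓢(ℝ, ℂ)) (ε : Eps) (f : ℝ → ℂ) :
    ∫ x, f x * scaled ρ ε (-x) = ∫ s : ℝ, f (-(ε * s)) * ρ s := by
  have hε := ε.pos
  calc ∫ x, f x * scaled ρ ε (-x)
      = ∫ x, (ε : ℝ)⁻¹ • (f (-(ε * (x / ε))) * ρ (x / ε)) := by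
        rw [← integral_neg_eq_self]
        simp only [scaled, neg_neg, mul_div_cancel₀ _ hε.ne', mul_smul_comm]
    _ = ∫ s : ℝ, f (-(ε * s)) * ρ s := by
        rw [integral_smul, Measure.integral_comp_div (fun s : ℝ => f (-(ε * s)) * ρ s),
          abs_of_pos hε, inv_smul_smul₀ hε.ne']

theorem tendsto_integral_mul_scaled_neg (ρ : 𝓢(ℝ, ℂ)) {f : ℝ → ℂ} (hf : Continuous f)
    (hb : ∃ M, ∀ x, ‖f x‖ ≤ M) :
    Tendsto (fun ε => ∫ x, f x * scaled ρ ε (-x)) epsZero (𝓝 (f 0 * ∫ s, ρ s)) := by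
  obtain ⟨M, hM⟩ := hb
  simp_rw [integral_mul_scaled_neg, ← integral_const_mul]
  have hρ := ρ.continuous
  refine tendsto_integral_filter_of_dominated_convergence (fun s => M * ‖ρ s‖)
    (Eventually.of_forall fun ε => by fun_prop)
    (Eventually.of_forall fun ε => Eventually.of_forall fun s => ?_)
    (ρ.integrable.norm.const_mul M) (Eventually.of_forall fun s => ?_)
  · rw [norm_mul]
    gcongr
    exact hM _
  · have h0 : Tendsto (fun ε : Eps => -(ε * s)) epsZero (𝓝 0) := by
      simpa using (tendsto_val_epsZero.mul_const s).neg
    exact ((hf.tendsto 0).comp h0).mul_const _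

theorem integrable_scaled (ρ : 𝓢(ℝ, ℂ)) (ε : Eps) : Integrable (scaled ρ ε) :=
  (ρ.integrable.comp_div ε.pos.ne').smul ((ε : ℝ)⁻¹)

/-! ### Nets converging to a distribution -/

/-- The net `u` converges to the distribution `w` as `ε → 0`, in the weak topology of `𝓓'(ℝ)`. -/
def ConvergesTo (u : Net) (w : Distr) : Prop :=
  ∀ φ : Test, Tendsto (fun ε => ∫ x, u ε x * (φ x : ℂ)) epsZero (𝓝 (w φ))

theorem convergesTo_conv {ρ : 𝓢(ℝ, ℂ)} (hρ : ∫ x, ρ x = 1) (w : Distr) (ψ : Test) :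
    ConvergesTo (fun ε => conv w ψ (scaled ρ ε) (contDiff_scaled ρ ε)) (mulDistr ψ.contDiff w) := by
  intro φ
  have hneg : HasCompactSupport fun x => (φ (-x) : ℂ) :=
    φ.hasCompactSupport_ofReal.comp_homeomorph (Homeomorph.neg ℝ)
  have hneg' := φ.contDiff_ofReal.comp contDiff_neg
  let f : bddSmooth := ⟨fun x => φ (-x), .of_hasCompactSupport hneg' hneg⟩
  have hf : Integrable f := φ.integrable_ofReal.comp_neg
  have hcomm (ε : Eps) : ∫ x, conv w ψ (scaled ρ ε) (contDiff_scaled ρ ε) x * (φ x : ℂ) =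
      ∫ x, conv w ψ f (isBddSmooth_coe f).smooth x * scaled ρ ε (-x) := by
    simpa [f] using integral_conv_mul_comm w ψ f ⟨_, isBddSmooth_scaled ρ ε⟩ hf
      (integrable_scaled ρ ε)
  have hzero : conv w ψ f (isBddSmooth_coe f).smooth 0 = mulDistr ψ.contDiff w φ := by
    rw [conv_eq_pairingCutoff, ← pairingCutoff_toBddSmooth]
    congr 1
    ext y
    simp [f, reflect, Test.toBddSmooth]
  have hlim := tendsto_integral_mul_scaled_neg ρ
    (contDiff_conv w ψ (isBddSmooth_coe f)).continuous (exists_norm_conv_le w ψ f)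
  simpa only [hcomm, hzero, hρ, mul_one] using hlim

theorem ConvergesTo.unique {u : Net} {w z : Distr} (hw : ConvergesTo u w) (hz : ConvergesTo u z) :
    w = z :=
  DFunLike.ext _ _ fun φ => tendsto_nhds_unique (hw φ) (hz φ)

theorem ConvergesTo.smul {u : Net} {w : Distr} (hu : ConvergesTo u w) (c : ℂ) :
    ConvergesTo (c • u) (c • w) := fun φ => by
  have h := (hu φ).const_mul c
  simp_rw [← integral_const_mul, ← mul_assoc] at h
  exact h

theorem ConvergesTo.sub {u v : Net} {w z : Distr} (hu : ConvergesTo u w) (hv : ConvergesTo v z)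
    (huc : ∀ ε, Continuous (u ε)) (hvc : ∀ ε, Continuous (v ε)) :
    ConvergesTo (u - v) (w - z) := fun φ => by
  refine ((hu φ).sub (hv φ)).congr fun ε => ?_
  rw [← integral_sub (φ.integrable_mul (huc ε)) (φ.integrable_mul (hvc ε))]
  simp_rw [← sub_mul]
  rfl

theorem ConvergesTo.mul_left {f : ℝ → ℝ} (hf : ContDiff ℝ ∞ f) {u : Net} {w : Distr}
    (hu : ConvergesTo u w) : ConvergesTo (fun ε x => (f x : ℂ) * u ε x) (mulDistr hf w) :=
  fun φ => (hu (mulTest hf φ)).congr fun ε => by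
    simp [mul_assoc, mul_left_comm]

theorem lineDeriv_apply (φ : Test) (x : ℝ) : (∂_{(1 : ℝ)} φ) x = deriv φ x := by
  rw [TestFunction.lineDerivOp_eq_lineDerivCLM ℝ, TestFunction.lineDerivCLM_eq_fderivCLM,
    TestFunction.fderivCLM_apply_of_le _ le_top]
  exact fderiv_apply_one_eq_deriv

theorem ConvergesTo.deriv {u : Net} {w : Distr} (hu : ConvergesTo u w)
    (huc : ∀ ε, ContDiff ℝ 1 (u ε)) : ConvergesTo (fun ε => deriv (u ε)) (∂_{(1 : ℝ)} w) := by
  intro φ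
  rw [Distribution.lineDerivOp_apply_apply]
  refine (hu (-∂_{(1 : ℝ)} φ)).congr fun ε => ?_
  have hd (x : ℝ) : HasDerivAt (fun y => (φ y : ℂ)) ((∂_{(1 : ℝ)} φ) x : ℝ) x := by
    rw [lineDeriv_apply]
    exact (φ.contDiff.differentiable (by simp) x).hasDerivAt.ofReal_comp
  have hparts := integral_mul_deriv_eq_deriv_mul_of_integrable
    (fun x _ => ((huc ε).differentiable one_ne_zero x).hasDerivAt) (fun x _ => hd x)
    (Test.integrable_mul (huc ε).continuous _)
    (φ.integrable_mul ((huc ε).continuous_deriv le_rfl)) (φ.integrable_mul (huc ε).continuous)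
  rw [← neg_eq_iff_eq_neg.2 hparts, ← integral_neg]
  simp

theorem IsNegligible.convergesTo_zero {n : Net} (hn : IsNegligible n) : ConvergesTo n 0 := by
  intro φ
  obtain ⟨C, hC⟩ := hn.bound _ φ.hasCompactSupport.isCompact 0 1
  refine squeeze_zero_norm' (a := fun ε : Eps => C * ε * ∫ x, ‖(φ x : ℂ)‖) ?_ ?_
  · filter_upwards [hC] with ε hε
    refine (norm_integral_le_of_norm_le (φ.integrable_ofReal.norm.const_mul (C * ε))
      (Eventually.of_forall fun x => ?_)).trans_eq (integral_const_mul _ _)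
    by_cases hx : φ x = 0
    · simp [hx]
    · rw [norm_mul]
      gcongr
      simpa using hε x (subset_tsupport _ hx)
  · simpa using (tendsto_val_epsZero.const_mul C).mul_const (∫ x, ‖(φ x : ℂ)‖)

theorem ConvergesTo.of_mk_eq {f g : Net} {hf : IsModerate f} {hg : IsModerate g}
    (h : mk f hf = mk g hg) {w : Distr} (hw : ConvergesTo f w) : ConvergesTo g w := by
  have hn : IsNegligible (f - g) := Ideal.Quotient.eq.1 h
  have hs := hw.sub hn.convergesTo_zero (fun ε => (hf.smooth ε).continuous)
    fun ε => (hn.smooth ε).continuous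
  rwa [sub_sub_cancel, sub_zero] at hs

theorem assoc_iff_eq {f g : Net} {hf : IsModerate f} {hg : IsModerate g} {w z : Distr}
    (hw : ConvergesTo f w) (hz : ConvergesTo g z) : Assoc (mk f hf) (mk g hg) ↔ w = z := by
  have hsub {f g : Net} (hf : IsModerate f) (hg : IsModerate g) (hw : ConvergesTo f w)
      (hz : ConvergesTo g z) : ConvergesTo (f - g) (w - z) :=
    hw.sub hz (fun ε => (hf.smooth ε).continuous) fun ε => (hg.smooth ε).continuous
  constructor
  · rintro ⟨f', g', hf', hg', hff', hgg', h⟩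
    have h0 : ConvergesTo (f' - g') 0 := h
    exact sub_eq_zero.1 ((hsub hf' hg' (hw.of_mk_eq hff') (hz.of_mk_eq hgg')).unique h0)
  · rintro rfl
    have h0 := hsub hf hg hw hz
    rw [sub_self] at h0
    exact ⟨f, g, hf, hg, rfl, rfl, h0⟩

/-! ### The embedded nets -/

namespace Localization

variable {J : Type*} (P : Localization J)

theorem contDiff_χ (j : J) : ContDiff ℝ ∞ (P.χ j) :=
  contMDiff_iff_contDiff.1 (P.χ j).contMDiff

theorem mulDistr_χ_mulDistr_ψ (w : Distr) (j : J) :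
    mulDistr (P.contDiff_χ j) (mulDistr (P.ψ j).contDiff w) = mulDistr (P.contDiff_χ j) w := by
  ext φ
  simp only [mulDistr_apply]
  congr 1
  ext x
  simp only [mulTest_apply]
  by_cases hj : P.χ j x = 0
  · simp [hj]
  · have hx : x ∈ closure (P.U j) := subset_closure (P.isSubordinate j (subset_tsupport _ hj))
    rw [(P.ψ_eq_one j).self_of_nhdsSet x hx, one_mul]

theorem finite_indices (φ : Test) :
    {j | (Function.support (P.χ j) ∩ tsupport φ).Nonempty}.Finite :=
  P.χ.locallyFinite.finite_nonempty_inter_compact φ.hasCompactSupport.isCompact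

/-- The finitely many indices `j` for which `χ j` meets the support of the test function `φ`. -/
noncomputable def indices (φ : Test) : Finset J :=
  (P.finite_indices φ).toFinset

theorem mem_indices {φ : Test} {j : J} {x : ℝ} (hj : P.χ j x ≠ 0) (hx : φ x ≠ 0) :
    j ∈ P.indices φ :=
  (P.finite_indices φ).mem_toFinset.2 ⟨x, hj, subset_tsupport _ hx⟩

theorem sum_mulTest_χ (φ : Test) : ∑ j ∈ P.indices φ, mulTest (P.contDiff_χ j) φ = φ := by
  ext x
  rw [FunLike.coe_sum, Finset.sum_apply]
  simp only [mulTest_apply]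
  by_cases hx : φ x = 0
  · simp [hx]
  · have hsum := P.χ.sum_eq_one (Set.mem_univ x)
    rw [finsum_eq_sum_of_support_subset _ fun j hj => P.mem_indices hj hx] at hsum
    rw [← Finset.sum_mul, hsum, one_mul]

theorem integral_embedNet_mul (ρ : 𝓢(ℝ, ℂ)) (w : Distr) (ε : Eps) (φ : Test) :
    ∫ x, embedNet ρ P w ε x * (φ x : ℂ) = ∑ j ∈ P.indices φ,
      ∫ x, P.χ j x * conv w (P.ψ j) (scaled ρ ε) (contDiff_scaled ρ ε) x * (φ x : ℂ) := by
  have hcont (j : J) : Continuous fun x =>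
      (P.χ j x : ℂ) * conv w (P.ψ j) (scaled ρ ε) (contDiff_scaled ρ ε) x :=
    (Complex.continuous_ofReal.comp (P.contDiff_χ j).continuous).mul
      (contDiff_conv w (P.ψ j) (isBddSmooth_scaled ρ ε)).continuous
  rw [← integral_finsetSum _ fun j _ => φ.integrable_mul (hcont j)]
  congr with x
  rw [← Finset.sum_mul]
  by_cases hx : φ x = 0
  · simp [hx]
  · congr 1
    refine finsum_eq_sum_of_support_subset _ fun j hj => P.mem_indices (fun h => hj ?_) hx
    simp [h]

end Localization

theorem convergesTo_embedNet {J : Type*} {ρ : 𝓢(ℝ, ℂ)} (hρ : ∫ x, ρ x = 1) (P : Localization J)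
    (w : Distr) : ConvergesTo (embedNet ρ P w) w := by
  have hterm (j : J) : ConvergesTo
      (fun ε x => P.χ j x * conv w (P.ψ j) (scaled ρ ε) (contDiff_scaled ρ ε) x)
      (mulDistr (P.contDiff_χ j) w) :=
    P.mulDistr_χ_mulDistr_ψ w j ▸ (convergesTo_conv hρ w (P.ψ j)).mul_left (P.contDiff_χ j)
  intro φ
  have hw : w φ = ∑ j ∈ P.indices φ, mulDistr (P.contDiff_χ j) w φ := by
    simp_rw [mulDistr_apply, ← map_sum, P.sum_mulTest_χ]
  simp_rw [hw, P.integral_embedNet_mul]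
  exact tendsto_finsetSum _ fun j _ => hterm j φ

end Colombeau

theorem mainTheorem9_general {J : Type*} (ρ : 𝓢(ℝ, ℂ)) (hρ : ∫ x, ρ x = 1)
    (P : Colombeau.Localization J) (w : Colombeau.Distr) {f : ℝ → ℝ} (hf : ContDiff ℝ ∞ f)
    (c : ℂ) :
    Colombeau.mulDistr hf (∂_{(1 : ℝ)} w) = c • w ↔
      Colombeau.Assoc (Colombeau.ofSmooth (fun x => f x) (Complex.ofRealCLM.contDiff.comp hf) *
        Colombeau.D (Colombeau.embed ρ P w)) (c • Colombeau.embed ρ P w) := by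
  have hv := Colombeau.isModerate_embedNet ρ P w
  have hw := Colombeau.convergesTo_embedNet hρ P w
  have hw' := (hw.deriv fun ε => (hv.smooth ε).of_le (by norm_num)).mul_left hf
  exact (Colombeau.assoc_iff_eq (hf := (Colombeau.isModerate_const
    (Complex.ofRealCLM.contDiff.comp hf)).mul hv.deriv) (hg := Colombeau.moderate.smul_mem hv c)
    hw' (hw.smul c)).symm

theorem mainTheorem9 {J : Type*} (ρ : 𝓢(ℝ, ℂ)) (hρ : Colombeau.IsMollifier ρ)
    (P : Colombeau.Localization J) (w : Colombeau.Distr) (u : Colombeau.ColombeauAlgebra)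
    (hu : u = Colombeau.embed ρ P w) (α : ℝ) :
    Colombeau.mulDistr (f := fun x : ℝ => x) contDiff_id (∂_{(1 : ℝ)} w) = α • w ↔
      Colombeau.Assoc (Colombeau.X * Colombeau.D u) ((α : ℂ) • u) := by
  subst hu
  exact mainTheorem9_general ρ hρ.integral_eq_one P w contDiff_id α
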